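/- Let $X$ and $Y$ be locally compact Hausdorff spaces. For a continuous map $f\colon X\to Y$, the unified space $X\uplus_f Y$ is the set $X\sqcup Y$ with the topology generated by the open subsets of $X$ together with the sets $\hat f^{-1}(V)\cap\big((X\sqcup Y)\setminus K\big)$ for $V\subseteq Y$ open and $K\subseteq X$ compact, where $\hat f\colon X\uplus_f Y\to Y$ is equal to $f$ on $X$ and to the identity on $Y$. For C*-algebras $A,B$ a morphism from $A$ to $B$ is a $*$-homomorphism $\varphi\colon A\to\mathcal M(B)$ such that the linear span of $\varphi(A)B$ is dense in $B$; the set of morphisms is denoted $\mathrm{Mor}(A,B)$. For an extension $0\to B\to E\xrightarrow{q}A\to 0$ of C*-algebras let $\alpha\colon E\to\mathcal M(B)$ be the $*$-homomorphism induced by the ideal $B$ of $E$ (so $\alpha(e)b=eb$); its Busby invariant is the $*$-homomorphism $\beta\colon A\to\mathcal M(B)/B$ with $\beta(q(e))=\alpha(e)+B$. The extension is split by a $*$-homomorphism $s\colon A\to E$ if $q\circ s=\mathrm{id}_A$. We identify $\mathcal M(C_0(X))$ with the algebra $C_b(X)$ of bounded continuous functions on $X$. (1) Let $f\colon X\to Y$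 be continuous. Then $X\uplus_f Y$ is locally compact and Hausdorff, and $\hat f$ is perfect (a proper continuous surjection). There is an extension $$0\to C_0(X)\to C_0(X\uplus_f Y)\xrightarrow{q}C_0(Y)\to 0,$$ in which $C_0(X)$ is included by extending functions by zero and $q$ is the restriction of functions to $Y$, and this extension is split by $\hat f^*\colon C_0(Y)\to C_0(X\uplus_f Y)$, $\hat f^*(h)=h\circ\hat f$. The map $f^*\colon C_0(Y)\to C_b(X)=\mathcal M(C_0(X))$, $f^*(h)=h\circ f$, belongs to $\mathrm{Mor}(C_0(Y),C_0(X))$; it is equal to $\alpha\circ\hat f^*$, and it is a lift of the Busby invariant of this extension. Moreover, $a\mapsto(a|_X,a|_Y)$ is a $*$-isomorphism $$C_0(X\uplus_f Y)\;\cong\;\{(g,h)\in C_b(X)\oplus C_0(Y)\mid g-f^*(h)\in C_0(X)\}.$$ (2) Conversely, let $0\to C_0(X)\xrightarrow{\iota}E\xrightarrow{q_E}C_0(Y)\to0$ be an extension of C*-algebras that is split by a $*$-homomorphism $s\colon C_0(Y)\to E$ for which the lift $\alpha\circ s$ of the Busby invariant belongs to $\mathrm{Mor}(C_0(Y),C_0(X))$.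 Then there are a continuous map $f\colon X\to Y$ and a $*$-isomorphism $\Phi\colon E\to C_0(X\uplus_f Y)$ that is an isomorphism of split extensions from $E$ onto the split extension in (1): $\Phi\circ\iota$ is the inclusion of $C_0(X)$, $q\circ\Phi=q_E$ and $\Phi\circ s=\hat f^*$. -/

import Mathlib

open scoped ZeroAtInfty MultiplierAlgebra BoundedContinuousFunction

noncomputable section

/-! ### The unified space of a continuous map -/

section UnifiedSpaceDefs

variable {X Y : Type*} [TopologicalSpace X] [TopologicalSpace Y]

/-- The underlying set of the unified space `X ⊎_f Y`: the disjoint union of `X` and `Y`. -/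
inductive UnifiedSpace (f : C(X, Y)) : Type _
  | inX (x : X) : UnifiedSpace f
  | inY (y : Y) : UnifiedSpace f

namespace UnifiedSpace

/-- The canonical map `X ⊎_f Y → Y`, equal to `f` on `X` and to the identity on `Y`. -/
def proj (f : C(X, Y)) : UnifiedSpace f → Y
  | inX x => f x
  | inY y => y

/-- The topology generated by the open subsets of `X` and by the sets
`proj⁻¹(V) ∩ ((X ⊔ Y) \ K)` with `V ⊆ Y` open and `K ⊆ X` compact. -/
instance instTopologicalSpace (f : C(X, Y)) : TopologicalSpace (UnifiedSpace f) :=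
  TopologicalSpace.generateFrom
    ({S | ∃ U : Set X, IsOpen U ∧ S = inX '' U} ∪
      {S | ∃ (V : Set Y) (K : Set X), IsOpen V ∧ IsCompact K ∧
        S = proj f ⁻¹' V ∩ (inX '' K)ᶜ})

end UnifiedSpace

end UnifiedSpaceDefs

/-! ### Multiplier and corona algebras, morphisms, extensions, the Busby invariant -/

section CStar

variable {A B E : Type*} [NonUnitalCStarAlgebra A] [NonUnitalCStarAlgebra B]
  [NonUnitalCStarAlgebra E]

/-- The copy of `B` in its multiplier algebra, as an ideal. -/
def multiplierIdeal (B : Type*) [NonUnitalCStarAlgebra B] : Ideal 𝓜(ℂ, B) where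
  carrier := Set.range (DoubleCentralizer.coeHom (𝕜 := ℂ) (A := B))
  add_mem' := by
    rintro _ _ ⟨a, rfl⟩ ⟨b, rfl⟩
    exact ⟨a + b, map_add _ _ _⟩
  zero_mem' := ⟨0, map_zero _⟩
  smul_mem' := by
    rintro m _ ⟨b, rfl⟩
    refine ⟨m.fst b, ?_⟩
    refine DoubleCentralizer.ext ℂ B _ _ (Prod.ext ?_ ?_)
    · refine ContinuousLinearMap.ext fun y => ?_
      change m.fst b * y = m.fst (b * y)
      have key : ∀ z : B, z * (m.fst b * y - m.fst (b * y)) = 0 := by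
        intro z
        rw [mul_sub, ← mul_assoc, ← m.central, ← m.central, mul_assoc, sub_self]
      have := key (star (m.fst b * y - m.fst (b * y)))
      rwa [CStarRing.star_mul_self_eq_zero_iff, sub_eq_zero] at this
    · refine ContinuousLinearMap.ext fun y => ?_
      change y * m.fst b = m.snd y * b
      exact (m.central y b).symm

theorem mem_multiplierIdeal {m : 𝓜(ℂ, B)} :
    m ∈ multiplierIdeal B ↔ ∃ b : B, DoubleCentralizer.coeHom (𝕜 := ℂ) b = m :=
  Iff.rfl

theorem star_mem_multiplierIdeal {m : 𝓜(ℂ, B)} (hm : m ∈ multiplierIdeal B) :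
    star m ∈ multiplierIdeal B := by
  obtain ⟨b, rfl⟩ := hm
  exact ⟨star b, map_star _ _⟩

instance : (multiplierIdeal B).IsTwoSided where
  mul_mem_of_left {m} n hm := by
    have h := (multiplierIdeal B).mul_mem_left (star n) (star_mem_multiplierIdeal hm)
    have h' := star_mem_multiplierIdeal h
    rwa [star_mul, star_star, star_star] at h'

/-- The corona algebra `𝒬(B) = ℳ(B) / B`. -/
abbrev Corona (B : Type*) [NonUnitalCStarAlgebra B] : Type _ :=
  𝓜(ℂ, B) ⧸ multiplierIdeal B

/-- The involution of the corona algebra, induced by that of `ℳ(B)`. -/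
instance Corona.instStar : Star (Corona B) where
  star := Quotient.map' star (by
    intro a b h
    rw [Submodule.quotientRel_def] at h ⊢
    rw [← star_sub]
    exact star_mem_multiplierIdeal h)

theorem Corona.star_mk (m : 𝓜(ℂ, B)) :
    star (Ideal.Quotient.mk (multiplierIdeal B) m) =
      Ideal.Quotient.mk (multiplierIdeal B) (star m) :=
  rfl

/-- The quotient map `ℳ(B) → 𝒬(B)`. -/
def coronaMk (B : Type*) [NonUnitalCStarAlgebra B] : 𝓜(ℂ, B) →⋆ₙₐ[ℂ] Corona B where
  toFun := Ideal.Quotient.mk (multiplierIdeal B)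
  map_smul' _ _ := rfl
  map_zero' := map_zero _
  map_add' := map_add _
  map_mul' := map_mul _
  map_star' m := (Corona.star_mk m).symm

/-- A `*`-homomorphism `φ : A → ℳ(B)` is a *morphism* from `A` to `B` if the linear span of the
products `φ(a) b` is dense in `B`. -/
def IsMorphism (φ : A →⋆ₙₐ[ℂ] 𝓜(ℂ, B)) : Prop :=
  Dense (Submodule.span ℂ {c : B | ∃ (a : A) (b : B), c = (φ a).fst b} : Set B)

/-- An extension of `A` by `B`: a short exact sequence `0 → B → E → A → 0` of C⋆-algebras and
`*`-homomorphisms. -/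
structure CStarExtension (B E A : Type*) [NonUnitalCStarAlgebra B] [NonUnitalCStarAlgebra E]
    [NonUnitalCStarAlgebra A] where
  /-- the inclusion of the ideal -/
  incl : B →⋆ₙₐ[ℂ] E
  /-- the quotient map -/
  quot : E →⋆ₙₐ[ℂ] A
  incl_injective : Function.Injective incl
  exact : Function.Exact incl quot
  quot_surjective : Function.Surjective quot

namespace CStarExtension

variable (ext : CStarExtension B E A)

/-- `s` splits the extension. -/
def IsSplitting (s : A →⋆ₙₐ[ℂ] E) : Prop :=
  ∀ a, ext.quot (s a) = a

theorem exists_incl_eq_mul (e : E) (b : B) : ∃ c, ext.incl c = e * ext.incl b :=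
  (ext.exact _).1 (by rw [map_mul, ext.exact.apply_apply_eq_zero, mul_zero])

theorem exists_incl_eq_mul' (e : E) (b : B) : ∃ c, ext.incl c = ext.incl b * e :=
  (ext.exact _).1 (by rw [map_mul, ext.exact.apply_apply_eq_zero, zero_mul])

/-- Left multiplication by `e : E` on the ideal `B`. -/
def mulLeft (e : E) : B →L[ℂ] B :=
  LinearMap.mkContinuous
    { toFun := fun b => (ext.exists_incl_eq_mul e b).choose
      map_add' := fun b c => ext.incl_injective (by
        refine (ext.exists_incl_eq_mul e (b + c)).choose_spec.trans ?_
        rw [map_add, map_add, (ext.exists_incl_eq_mul e b).choose_spec,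
          (ext.exists_incl_eq_mul e c).choose_spec, mul_add])
      map_smul' := fun r b => ext.incl_injective (by
        refine (ext.exists_incl_eq_mul e (r • b)).choose_spec.trans ?_
        rw [RingHom.id_apply, map_smul, map_smul, (ext.exists_incl_eq_mul e b).choose_spec,
          mul_smul_comm]) }
    ‖e‖ (fun b => by
      rw [← NonUnitalStarAlgHom.norm_map ext.incl ext.incl_injective,
        ← NonUnitalStarAlgHom.norm_map ext.incl ext.incl_injective b]
      exact (congrArg norm (ext.exists_incl_eq_mul e b).choose_spec).trans_le (norm_mul_le _ _))

theorem incl_mulLeft (e : E) (b : B) : ext.incl (ext.mulLeft e b) = e * ext.incl b :=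
  (ext.exists_incl_eq_mul e b).choose_spec

/-- Right multiplication by `e : E` on the ideal `B`. -/
def mulRight (e : E) : B →L[ℂ] B :=
  LinearMap.mkContinuous
    { toFun := fun b => (ext.exists_incl_eq_mul' e b).choose
      map_add' := fun b c => ext.incl_injective (by
        refine (ext.exists_incl_eq_mul' e (b + c)).choose_spec.trans ?_
        rw [map_add, map_add, (ext.exists_incl_eq_mul' e b).choose_spec,
          (ext.exists_incl_eq_mul' e c).choose_spec, add_mul])
      map_smul' := fun r b => ext.incl_injective (by
        refine (ext.exists_incl_eq_mul' e (r • b)).choose_spec.trans ?_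
        rw [RingHom.id_apply, map_smul, map_smul, (ext.exists_incl_eq_mul' e b).choose_spec,
          smul_mul_assoc]) }
    ‖e‖ (fun b => by
      rw [← NonUnitalStarAlgHom.norm_map ext.incl ext.incl_injective,
        ← NonUnitalStarAlgHom.norm_map ext.incl ext.incl_injective b, mul_comm]
      exact (congrArg norm (ext.exists_incl_eq_mul' e b).choose_spec).trans_le (norm_mul_le _ _))

theorem incl_mulRight (e : E) (b : B) : ext.incl (ext.mulRight e b) = ext.incl b * e :=
  (ext.exists_incl_eq_mul' e b).choose_spec

/-- The morphism `α : E → ℳ(B)` induced by the ideal `B` of `E`; it satisfies `α(e) b = e b`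
and `b α(e) = b e`. -/
def toMultiplier : E →⋆ₙₐ[ℂ] 𝓜(ℂ, B) where
  toFun e :=
    { fst := ext.mulLeft e
      snd := ext.mulRight e
      central := fun x y => ext.incl_injective (by
        rw [map_mul, map_mul, incl_mulLeft, incl_mulRight, mul_assoc]) }
  map_smul' r e := by
    refine DoubleCentralizer.ext ℂ B _ _ (Prod.ext ?_ ?_) <;>
      refine ContinuousLinearMap.ext fun b => ext.incl_injective ?_
    · change ext.incl (ext.mulLeft (r • e) b) = ext.incl (r • ext.mulLeft e b)
      rw [map_smul, incl_mulLeft, incl_mulLeft, smul_mul_assoc]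
    · change ext.incl (ext.mulRight (r • e) b) = ext.incl (r • ext.mulRight e b)
      rw [map_smul, incl_mulRight, incl_mulRight, mul_smul_comm]
  map_zero' := by
    refine DoubleCentralizer.ext ℂ B _ _ (Prod.ext ?_ ?_) <;>
      refine ContinuousLinearMap.ext fun b => ext.incl_injective ?_
    · change ext.incl (ext.mulLeft 0 b) = ext.incl 0
      rw [map_zero, incl_mulLeft, zero_mul]
    · change ext.incl (ext.mulRight 0 b) = ext.incl 0
      rw [map_zero, incl_mulRight, mul_zero]
  map_add' e e' := by
    refine DoubleCentralizer.ext ℂ B _ _ (Prod.ext ?_ ?_) <;>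
      refine ContinuousLinearMap.ext fun b => ext.incl_injective ?_
    · change ext.incl (ext.mulLeft (e + e') b) = ext.incl (ext.mulLeft e b + ext.mulLeft e' b)
      rw [map_add, incl_mulLeft, incl_mulLeft, incl_mulLeft, add_mul]
    · change ext.incl (ext.mulRight (e + e') b) = ext.incl (ext.mulRight e b + ext.mulRight e' b)
      rw [map_add, incl_mulRight, incl_mulRight, incl_mulRight, mul_add]
  map_mul' e e' := by
    refine DoubleCentralizer.ext ℂ B _ _ (Prod.ext ?_ ?_) <;>
      refine ContinuousLinearMap.ext fun b => ext.incl_injective ?_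
    · change ext.incl (ext.mulLeft (e * e') b) = ext.incl (ext.mulLeft e (ext.mulLeft e' b))
      rw [incl_mulLeft, incl_mulLeft, incl_mulLeft, mul_assoc]
    · change ext.incl (ext.mulRight (e * e') b) = ext.incl (ext.mulRight e' (ext.mulRight e b))
      rw [incl_mulRight, incl_mulRight, incl_mulRight, mul_assoc]
  map_star' e := by
    refine DoubleCentralizer.ext ℂ B _ _ (Prod.ext ?_ ?_) <;>
      refine ContinuousLinearMap.ext fun b => ext.incl_injective ?_
    · change ext.incl (ext.mulLeft (star e) b) = ext.incl (star (ext.mulRight e (star b)))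
      rw [map_star, incl_mulLeft, incl_mulRight, star_mul, map_star, star_star]
    · change ext.incl (ext.mulRight (star e) b) = ext.incl (star (ext.mulLeft e (star b)))
      rw [map_star, incl_mulLeft, incl_mulRight, star_mul, map_star, star_star]

theorem coronaMk_toMultiplier_eq {e e' : E} (h : ext.quot e = ext.quot e') :
    coronaMk B (ext.toMultiplier e) = coronaMk B (ext.toMultiplier e') := by
  obtain ⟨b, hb⟩ := (ext.exact (e - e')).1 (by rw [map_sub, h, sub_self])
  refine Ideal.Quotient.eq.2 (mem_multiplierIdeal.2 ⟨b, ?_⟩)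
  rw [← map_sub, ← hb]
  refine DoubleCentralizer.ext ℂ B _ _ (Prod.ext ?_ ?_) <;>
    refine ContinuousLinearMap.ext fun c => ext.incl_injective ?_
  · change ext.incl (b * c) = ext.incl (ext.mulLeft (ext.incl b) c)
    rw [incl_mulLeft, map_mul]
  · change ext.incl (c * b) = ext.incl (ext.mulRight (ext.incl b) c)
    rw [incl_mulRight, map_mul]

/-- The Busby invariant `β : A → 𝒬(B)`: the map induced by `α : E → ℳ(B)` on the quotients,
`β(q(e)) = α(e) + B`. -/
def busby : A →⋆ₙₐ[ℂ] Corona B where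
  toFun a := coronaMk B (ext.toMultiplier (Function.surjInv ext.quot_surjective a))
  map_smul' r a := by
    rw [MonoidHom.id_apply, ← map_smul, ← map_smul]
    apply coronaMk_toMultiplier_eq
    simp only [map_smul, Function.surjInv_eq]
  map_zero' := by
    rw [← map_zero (coronaMk B), ← map_zero ext.toMultiplier]
    apply coronaMk_toMultiplier_eq
    simp only [map_zero, Function.surjInv_eq]
  map_add' a a' := by
    rw [← map_add, ← map_add]
    apply coronaMk_toMultiplier_eq
    simp only [map_add, Function.surjInv_eq]
  map_mul' a a' := by
    rw [← map_mul, ← map_mul]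
    apply coronaMk_toMultiplier_eq
    simp only [map_mul, Function.surjInv_eq]
  map_star' a := by
    rw [← map_star, ← map_star]
    apply coronaMk_toMultiplier_eq
    simp only [map_star, Function.surjInv_eq]

theorem busby_quot (e : E) : ext.busby (ext.quot e) = coronaMk B (ext.toMultiplier e) :=
  ext.coronaMk_toMultiplier_eq (Function.surjInv_eq _ _)

end CStarExtension

end CStar

/-! ### Function algebras -/

section FunctionAlgebras

variable {X Y : Type*} [TopologicalSpace X] [TopologicalSpace Y]

/-- The product of a bounded continuous function and a function vanishing at infinity. -/
def mulC0 (g : X →ᵇ ℂ) (k : C₀(X, ℂ)) : C₀(X, ℂ) where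
  toFun x := g x * k x
  continuous_toFun := g.continuous.mul (map_continuous k)
  zero_at_infty' := by
    have h := (zero_at_infty k).norm.const_mul ‖g‖
    rw [norm_zero, mul_zero] at h
    refine squeeze_zero_norm (fun x => ?_) h
    rw [norm_mul]
    exact mul_le_mul_of_nonneg_right (g.norm_coe_le_norm x) (norm_nonneg _)

@[simp]
theorem mulC0_apply (g : X →ᵇ ℂ) (k : C₀(X, ℂ)) (x : X) : mulC0 g k x = g x * k x :=
  rfl

/-- Multiplication by `g ∈ C_b(X)` as a bounded operator on `C₀(X)`. -/
def mulC0CLM (g : X →ᵇ ℂ) : C₀(X, ℂ) →L[ℂ] C₀(X, ℂ) :=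
  LinearMap.mkContinuous
    { toFun := mulC0 g
      map_add' := fun k l => ZeroAtInftyContinuousMap.ext fun x => mul_add (g x) (k x) (l x)
      map_smul' := fun r k => ZeroAtInftyContinuousMap.ext fun x =>
        mul_left_comm (g x) r (k x) }
    ‖g‖ (fun k => by
      rw [← ZeroAtInftyContinuousMap.norm_toBCF_eq_norm,
        ← ZeroAtInftyContinuousMap.norm_toBCF_eq_norm (f := k)]
      exact norm_mul_le g k.toBCF)

/-- The identification `C_b(X) → ℳ(C₀(X))`: a bounded continuous function acts on `C₀(X)` by
pointwise multiplication. -/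
def bcfToMultiplier (X : Type*) [TopologicalSpace X] : (X →ᵇ ℂ) →⋆ₙₐ[ℂ] 𝓜(ℂ, C₀(X, ℂ)) where
  toFun g :=
    { fst := mulC0CLM g
      snd := mulC0CLM g
      central := fun k l => ZeroAtInftyContinuousMap.ext fun x => by
        change g x * k x * l x = k x * (g x * l x)
        ring }
  map_smul' r g := by
    refine DoubleCentralizer.ext ℂ _ _ _ (Prod.ext ?_ ?_) <;>
      exact ContinuousLinearMap.ext fun k => ZeroAtInftyContinuousMap.ext fun x =>
        mul_assoc r (g x) (k x)
  map_zero' := by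
    refine DoubleCentralizer.ext ℂ _ _ _ (Prod.ext ?_ ?_) <;>
      exact ContinuousLinearMap.ext fun k => ZeroAtInftyContinuousMap.ext fun x =>
        zero_mul (k x)
  map_add' g h := by
    refine DoubleCentralizer.ext ℂ _ _ _ (Prod.ext ?_ ?_) <;>
      exact ContinuousLinearMap.ext fun k => ZeroAtInftyContinuousMap.ext fun x =>
        add_mul (g x) (h x) (k x)
  map_mul' g h := by
    refine DoubleCentralizer.ext ℂ _ _ _ (Prod.ext ?_ ?_) <;>
      refine ContinuousLinearMap.ext fun k => ZeroAtInftyContinuousMap.ext fun x => ?_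
    · exact mul_assoc (g x) (h x) (k x)
    · change g x * h x * k x = h x * (g x * k x)
      ring
  map_star' g := by
    refine DoubleCentralizer.ext ℂ _ _ _ (Prod.ext ?_ ?_) <;>
      refine ContinuousLinearMap.ext fun k => ZeroAtInftyContinuousMap.ext fun x => ?_ <;>
    · change star (g x) * k x = star (g x * star (k x))
      rw [star_mul', star_star]

/-- `f* : C₀(Y) → C_b(X)`, `f*(h) = h ∘ f`. -/
def pullbackBCF (f : C(X, Y)) : C₀(Y, ℂ) →⋆ₙₐ[ℂ] (X →ᵇ ℂ) where
  toFun h := h.toBCF.compContinuous f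
  map_smul' _ _ := rfl
  map_zero' := rfl
  map_add' _ _ := rfl
  map_mul' _ _ := rfl
  map_star' _ := rfl

/-- `f*` as a `*`-homomorphism `C₀(Y) → ℳ(C₀(X))`. -/
def pullbackMultiplier (f : C(X, Y)) : C₀(Y, ℂ) →⋆ₙₐ[ℂ] 𝓜(ℂ, C₀(X, ℂ)) :=
  (bcfToMultiplier X).comp (pullbackBCF f)

/-- The `*`-algebra `{(g, h) ∈ C_b(X) ⊕ C₀(Y) | g - f*(h) ∈ C₀(X)}`. -/
def unifiedAlgebra (f : C(X, Y)) : NonUnitalStarSubalgebra ℂ ((X →ᵇ ℂ) × C₀(Y, ℂ)) where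
  carrier := {p | ∃ k : C₀(X, ℂ), k.toBCF = p.1 - pullbackBCF f p.2}
  add_mem' := by
    rintro p p' ⟨k, hk⟩ ⟨k', hk'⟩
    refine ⟨k + k', ?_⟩
    change k.toBCF + k'.toBCF = _
    rw [hk, hk', Prod.fst_add, Prod.snd_add, map_add]
    abel
  zero_mem' := ⟨0, by rw [Prod.fst_zero, Prod.snd_zero, map_zero, sub_zero]; rfl⟩
  mul_mem' := by
    rintro p p' ⟨k, hk⟩ ⟨k', hk'⟩
    refine ⟨mulC0 p.1 k' + mulC0 (pullbackBCF f p'.2) k, ?_⟩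
    change p.1 * k'.toBCF + pullbackBCF f p'.2 * k.toBCF = _
    rw [hk, hk', Prod.fst_mul, Prod.snd_mul, map_mul]
    ring
  smul_mem' := by
    rintro r p ⟨k, hk⟩
    refine ⟨r • k, ?_⟩
    change r • k.toBCF = _
    rw [hk, Prod.smul_fst, Prod.smul_snd, map_smul, smul_sub]
  star_mem' := by
    rintro p ⟨k, hk⟩
    refine ⟨star k, ?_⟩
    change star k.toBCF = _
    rw [hk, Prod.fst_star, Prod.snd_star, map_star, star_sub]

/-- An extension of `C₀(Y)` by `C₀(X)` with algebra `C₀(X ⊎_f Y)` and a map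
`s : C₀(Y) → C₀(X ⊎_f Y)` are the canonical ones: the ideal `C₀(X)` is included by extending
functions by zero, the quotient map is restriction of functions to `Y`, and `s` is composition
with the canonical map `X ⊎_f Y → Y`. -/
structure IsUnifiedExtension (f : C(X, Y))
    (ext : CStarExtension C₀(X, ℂ) C₀(UnifiedSpace f, ℂ) C₀(Y, ℂ))
    (s : C₀(Y, ℂ) →⋆ₙₐ[ℂ] C₀(UnifiedSpace f, ℂ)) : Prop where
  incl_inX : ∀ (k : C₀(X, ℂ)) (x : X), ext.incl k (UnifiedSpace.inX x) = k x
  incl_inY : ∀ (k : C₀(X, ℂ)) (y : Y), ext.incl k (UnifiedSpace.inY y) = 0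
  quot_apply : ∀ (a : C₀(UnifiedSpace f, ℂ)) (y : Y), ext.quot a y = a (UnifiedSpace.inY y)
  section_apply : ∀ (h : C₀(Y, ℂ)) (z : UnifiedSpace f), s h z = h (UnifiedSpace.proj f z)

end FunctionAlgebras

end

open Filter Topology
open scoped ComplexOrder

/-! ### Functions vanishing at infinity -/

section ZeroAtInfty

variable {X Y : Type*} [TopologicalSpace X] [TopologicalSpace Y]

/-! A net escaping every compact subset of `X` whose image under `proj f` tends to `y` must tend to
`inY y` in the unified space. Hence `proj f` is proper (`UnifiedSpace.isProperMap_proj`), so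
composition with it preserves vanishing at infinity and splits the restriction to `Y`. Functions
vanishing on `Y` are exactly the extensions by zero of functions in `C₀(X)`, because their
superlevel sets are compact subsets of `X`. Applied to `a - pullbackHom f (restrictHom f a)`, this
gives the pullback description.

The converse combines two facts. A split extension is the vector space `B ⊕ A` with a product in
which only the cross terms involve the extension, and these are given by `α ∘ s`; so `α ∘ s`
determines the split extension (`exists_equiv_of_toMultiplier_comp_eq`). And every morphism from
`C₀(Y)` to `C₀(X)` is some `f*` (`IsMorphism.exists_eq_pullbackMultiplier`): a point `x` gives a
character of the multiplier algebra, whose pullback to `C₀(Y)` is nonzero by density and hence is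
evaluation at a point `f x`. -/

theorem ZeroAtInftyContinuousMap.isCompact_le_norm (k : C₀(X, ℂ)) {ε : ℝ} (hε : 0 < ε) :
    IsCompact {x | ε ≤ ‖k x‖} := by
  have h : ∀ᶠ x in cocompact X, ‖k x‖ < ε := by
    have := (zero_at_infty k).norm
    rw [norm_zero] at this
    exact this.eventually_lt_const hε
  obtain ⟨K, hK, hKs⟩ := mem_cocompact.1 h
  refine hK.of_isClosed_subset (isClosed_le continuous_const (map_continuous k).norm) ?_
  intro x hx
  by_contra hxK
  exact not_lt.2 hx (Set.mem_ofPred.1 (hKs hxK))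

theorem tendsto_cocompact_zero_of_isCompact {k : X → ℂ}
    (h : ∀ ε > 0, IsCompact {x | ε ≤ ‖k x‖}) : Tendsto k (cocompact X) (𝓝 0) := by
  rw [Metric.tendsto_nhds]
  intro ε hε
  filter_upwards [(h ε hε).compl_mem_cocompact] with x hx
  rw [dist_zero_right]
  exact not_le.1 hx

theorem ZeroAtInftyContinuousMap.norm_le_of_forall (k : C₀(X, ℂ)) {C : ℝ} (hC : 0 ≤ C)
    (h : ∀ x, ‖k x‖ ≤ C) : ‖k‖ ≤ C := by
  rw [← ZeroAtInftyContinuousMap.norm_toBCF_eq_norm]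
  exact (BoundedContinuousFunction.norm_le hC).2 h

theorem ZeroAtInftyContinuousMap.norm_apply_le_norm (k : C₀(X, ℂ)) (x : X) : ‖k x‖ ≤ ‖k‖ := by
  rw [← ZeroAtInftyContinuousMap.norm_toBCF_eq_norm]
  exact k.toBCF.norm_coe_le_norm x

/-- Composition with a continuous map that is proper at infinity, as a `*`-homomorphism. -/
noncomputable def ZeroAtInftyContinuousMap.compStarHom (g : CocompactMap X Y) :
    C₀(Y, ℂ) →⋆ₙₐ[ℂ] C₀(X, ℂ) where
  toFun h := h.comp g
  map_smul' _ _ := rfl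
  map_zero' := rfl
  map_add' _ _ := rfl
  map_mul' _ _ := rfl
  map_star' _ := rfl

/-- A version of Urysohn's lemma in `C₀(Y)`. -/
theorem exists_zeroAtInfty_eq_one_of_isCompact [LocallyCompactSpace Y] [T2Space Y] {K U : Set Y}
    (hK : IsCompact K) (hU : IsOpen U) (hKU : K ⊆ U) :
    ∃ h : C₀(Y, ℂ), (∀ y ∈ K, h y = 1) ∧ (∀ y ∉ U, h y = 0) ∧ ∀ y, ‖1 - h y‖ ≤ 1 := by
  obtain ⟨u, hu1, hu0, huc, hu⟩ := exists_continuous_one_zero_of_isCompact hK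
    hU.isClosed_compl (Set.disjoint_compl_right_iff_subset.2 hKU)
  refine ⟨⟨⟨fun y => (u y : ℂ), by fun_prop⟩, ?_⟩, fun y hy => ?_, fun y hy => ?_, fun y => ?_⟩
  · have := (Complex.continuous_ofReal.tendsto 0).comp huc.is_zero_at_infty
    rwa [Complex.ofReal_zero] at this
  · change (u y : ℂ) = 1
    simp [hu1 hy]
  · change (u y : ℂ) = 0
    simp [hu0 hy]
  · change ‖1 - (u y : ℂ)‖ ≤ 1
    rw [← Complex.ofReal_one, ← Complex.ofReal_sub, Complex.norm_real, Real.norm_eq_abs, abs_le]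
    constructor <;> linarith [(hu y).1, (hu y).2]

theorem exists_zeroAtInfty_apply_eq_one [LocallyCompactSpace Y] [T2Space Y] {y : Y} {U : Set Y}
    (hU : IsOpen U) (hy : y ∈ U) : ∃ h : C₀(Y, ℂ), h y = 1 ∧ ∀ z ∉ U, h z = 0 := by
  obtain ⟨h, h1, h0, -⟩ := exists_zeroAtInfty_eq_one_of_isCompact (isCompact_singleton (x := y)) hU
    (Set.singleton_subset_iff.2 hy)
  exact ⟨h, h1 y rfl, h0⟩

/-- If the kernel of a character has no common zero, it contains, for each compact set, a
nonnegative function without zeros on this set. -/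
theorem exists_nonneg_mem_ker_of_isCompact (φ : C₀(Y, ℂ) →⋆ₙₐ[ℂ] ℂ)
    (hφ : ∀ y, ∃ h, φ h = 0 ∧ h y ≠ 0) {K : Set Y} (hK : IsCompact K) :
    ∃ h, φ h = 0 ∧ (∀ y, 0 ≤ h y) ∧ ∀ y ∈ K, h y ≠ 0 := by
  refine hK.induction_on ⟨0, map_zero φ, fun _ => le_rfl, fun _ h => h.elim⟩ ?_ ?_ ?_
  · rintro s t hst ⟨h, h0, h1, h2⟩
    exact ⟨h, h0, h1, fun y hy => h2 y (hst hy)⟩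
  · rintro s t ⟨h, h0, h1, h2⟩ ⟨h', h0', h1', h2'⟩
    refine ⟨h + h', by rw [map_add, h0, h0', add_zero], fun y => add_nonneg (h1 y) (h1' y), ?_⟩
    rintro y hy hyz
    obtain ⟨hz, hz'⟩ := (add_eq_zero_iff_of_nonneg (h1 y) (h1' y)).1 hyz
    exact hy.elim (fun hy => h2 y hy hz) (fun hy => h2' y hy hz')
  · intro y _
    obtain ⟨h, h0, h1⟩ := hφ y
    refine ⟨{z | h z ≠ 0}, mem_nhdsWithin_of_mem_nhds
      (((map_continuous h).isOpen_preimage _ isOpen_ne).mem_nhds h1), star h * h, ?_, ?_, ?_⟩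
    · rw [map_mul, h0, mul_zero]
    · exact fun z => star_mul_self_nonneg (h z)
    · exact fun z hz => mul_ne_zero (star_ne_zero.2 hz) hz

/-- Every nonzero character of `C₀(Y)` is the evaluation at a point. -/
theorem exists_eq_eval_of_ne_zero [LocallyCompactSpace Y] [T2Space Y] (φ : C₀(Y, ℂ) →⋆ₙₐ[ℂ] ℂ)
    (hφ : ∃ h, φ h ≠ 0) : ∃ y, ∀ h, φ h = h y := by
  by_contra! hne
  have hker : ∀ y, ∃ h, φ h = 0 ∧ h y ≠ 0 := by
    intro y
    obtain ⟨h, hh⟩ := hne y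
    obtain ⟨v, hv, -⟩ := exists_zeroAtInfty_apply_eq_one isOpen_univ (Set.mem_univ y)
    -- This is `(h - φ h) v`, with `v` standing in for the unit, which `C₀(Y)` may lack.
    refine ⟨h * v - φ h • v, ?_, ?_⟩
    · rw [map_sub, map_mul, map_smul, smul_eq_mul, sub_self]
    · change h y * v y - φ h * v y ≠ 0
      rw [hv, mul_one, mul_one]
      exact sub_ne_zero.2 hh.symm
  obtain ⟨u₀, hu₀⟩ := hφ
  obtain ⟨u, hu⟩ : ∃ u, φ u = 1 :=
    ⟨(φ u₀)⁻¹ • u₀, by rw [map_smul, smul_eq_mul, inv_mul_cancel₀ hu₀]⟩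
  -- The aim is an element of the kernel within `1 / 2` of `u`; as `φ u = 1` and `φ` is contractive,
  -- this is absurd. The compact set where `‖u‖ ≥ 1 / 2` is the only place where care is needed.
  have hK := u.isCompact_le_norm (half_pos one_pos)
  obtain ⟨H, hH0, hHnn, hHne⟩ := exists_nonneg_mem_ker_of_isCompact φ hker hK
  have hHre : ∀ y, H y = ((H y).re : ℂ) := fun y =>
    Complex.ext rfl (Complex.nonneg_iff.1 (hHnn y)).2.symm
  have hcont : Continuous fun y => (H y).re := Complex.continuous_re.comp (map_continuous H)
  obtain ⟨δ, hδ, hδH⟩ : ∃ δ > 0, ∀ y ∈ {y | 1 / 2 ≤ ‖u y‖}, δ ≤ (H y).re := by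
    rcases Set.eq_empty_or_nonempty {y | 1 / 2 ≤ ‖u y‖} with he | hne
    · exact ⟨1, one_pos, fun y hy => by rw [he] at hy; exact hy.elim⟩
    · obtain ⟨y₀, hy₀, hmin⟩ := hK.exists_isMinOn hne hcont.continuousOn
      refine ⟨(H y₀).re, lt_of_le_of_ne (Complex.nonneg_iff.1 (hHnn y₀)).1 fun h => ?_, hmin⟩
      exact hHne y₀ hy₀ (by rw [hHre, ← h, Complex.ofReal_zero])
  have hpos : ∀ y, 0 < max (H y).re δ := fun y => lt_max_of_lt_right hδ
  -- Truncating at `δ` keeps the inverse of `H` bounded: `H w` takes values in `[0, 1]` and equals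
  -- `1` where `‖u‖ ≥ 1 / 2`.
  let w : Y →ᵇ ℂ := BoundedContinuousFunction.ofNormedAddCommGroup
    (fun y => (((max (H y).re δ)⁻¹ : ℝ) : ℂ))
    (Complex.continuous_ofReal.comp ((hcont.max continuous_const).inv₀ fun y => (hpos y).ne'))
    δ⁻¹ (fun y => by
      rw [Complex.norm_real, Real.norm_of_nonneg (inv_nonneg.2 (hpos y).le)]
      exact inv_anti₀ hδ (le_max_right _ _))
  have hsmall : ‖u - H * mulC0 w u‖ ≤ 1 / 2 := by
    refine ZeroAtInftyContinuousMap.norm_le_of_forall _ (by norm_num) fun y => ?_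
    have hval : (u - H * mulC0 w u) y =
        ((1 - (H y).re * (max (H y).re δ)⁻¹ : ℝ) : ℂ) * u y := by
      change u y - H y * ((((max (H y).re δ)⁻¹ : ℝ) : ℂ) * u y) = _
      rw [hHre y]
      push_cast
      simp only [Complex.ofReal_re]
      ring
    rw [hval, norm_mul, Complex.norm_real]
    by_cases hy : 1 / 2 ≤ ‖u y‖
    · have hle := hδH y hy
      rw [max_eq_left hle, mul_inv_cancel₀ (hδ.trans_le hle).ne', sub_self, norm_zero, zero_mul]
      norm_num
    · have h0 : 0 ≤ (H y).re * (max (H y).re δ)⁻¹ :=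
        mul_nonneg (Complex.nonneg_iff.1 (hHnn y)).1 (inv_nonneg.2 (hpos y).le)
      have h1 : (H y).re * (max (H y).re δ)⁻¹ ≤ 1 := by
        rw [← div_eq_mul_inv]
        exact div_le_one_of_le₀ (le_max_left _ _) (hpos y).le
      have h2 : ‖1 - (H y).re * (max (H y).re δ)⁻¹‖ ≤ 1 := by
        rw [Real.norm_of_nonneg (by linarith)]
        linarith
      exact (mul_le_of_le_one_left (norm_nonneg _) h2).trans (not_le.1 hy).le
  have hval : φ (u - H * mulC0 w u) = 1 := by
    rw [map_sub, map_mul, hH0, zero_mul, sub_zero, hu]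
  have := NonUnitalStarAlgHom.norm_apply_le φ (u - H * mulC0 w u)
  rw [hval, norm_one] at this
  linarith

end ZeroAtInfty

/-! ### The topology of the unified space -/

namespace UnifiedSpace

variable {X Y : Type*} [TopologicalSpace X] [TopologicalSpace Y] (f : C(X, Y))

theorem inX_injective : Function.Injective (inX : X → UnifiedSpace f) :=
  fun _ _ h => by injection h

theorem isOpen_image_inX {U : Set X} (hU : IsOpen U) :
    IsOpen ((inX : X → UnifiedSpace f) '' U) :=
  TopologicalSpace.isOpen_generateFrom_of_mem (Or.inl ⟨U, hU, rfl⟩)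

theorem isOpen_preimage_proj_inter {V : Set Y} {K : Set X} (hV : IsOpen V) (hK : IsCompact K) :
    IsOpen (proj f ⁻¹' V ∩ (inX '' K)ᶜ) :=
  TopologicalSpace.isOpen_generateFrom_of_mem (Or.inr ⟨V, K, hV, hK, rfl⟩)

theorem isOpen_compl_image_inX {K : Set X} (hK : IsCompact K) :
    IsOpen ((inX : X → UnifiedSpace f) '' K)ᶜ := by
  simpa using isOpen_preimage_proj_inter f isOpen_univ hK

theorem inY_notMem_image_inX (y : Y) (K : Set X) : inY y ∉ (inX : X → UnifiedSpace f) '' K := by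
  rintro ⟨x, -, hx⟩
  cases hx

theorem continuous_proj : Continuous (proj f) :=
  continuous_def.2 fun V hV => by simpa using isOpen_preimage_proj_inter f hV isCompact_empty

theorem surjective_proj : Function.Surjective (proj f) := fun y => ⟨inY y, rfl⟩

/-- The generators of the second kind meet `X` in `f⁻¹(V) \ K`, which is open because compact sets
in a Hausdorff space are closed. -/
theorem isOpenEmbedding_inX [T2Space X] : IsOpenEmbedding (inX : X → UnifiedSpace f) := by
  refine .of_continuous_injective_isOpenMap (continuous_generateFrom_iff.2 ?_)
    (inX_injective f) fun U hU => isOpen_image_inX f hU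
  rintro _ (⟨U, hU, rfl⟩ | ⟨V, K, hV, hK, rfl⟩)
  · rwa [Set.preimage_image_eq _ (inX_injective f)]
  · rw [Set.preimage_inter, Set.preimage_compl, Set.preimage_image_eq _ (inX_injective f)]
    exact (hV.preimage f.continuous).inter hK.isClosed.isOpen_compl

theorem range_inY : Set.range (inY : Y → UnifiedSpace f) = (Set.range inX)ᶜ := by
  ext (x | y) <;> simp

theorem isClosedEmbedding_inY : IsClosedEmbedding (inY : Y → UnifiedSpace f) := by
  have hc : Continuous (inY : Y → UnifiedSpace f) := by
    refine continuous_generateFrom_iff.2 ?_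
    rintro _ (⟨U, hU, rfl⟩ | ⟨V, K, hV, hK, rfl⟩)
    · convert isOpen_empty
      exact Set.eq_empty_of_forall_notMem fun y => inY_notMem_image_inX f y U
    · convert hV
      ext y
      exact and_iff_left (inY_notMem_image_inX f y K)
  refine ⟨.of_leftInverse (f := proj f) (fun _ => rfl) (continuous_proj f) hc, ?_⟩
  rw [range_inY, isClosed_compl_iff, ← Set.image_univ]
  exact isOpen_image_inX f isOpen_univ

theorem compl_image_inX_mem_nhds {K : Set X} (hK : IsCompact K) (y : Y) :
    ((inX : X → UnifiedSpace f) '' K)ᶜ ∈ 𝓝 (inY y) :=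
  (isOpen_compl_image_inX f hK).mem_nhds (inY_notMem_image_inX f y K)

/-- A point of `X` is separated from all of `Y` by a compact neighbourhood and its complement; two
points of `Y` are separated by preimages under `proj f`. -/
instance [LocallyCompactSpace X] [T2Space X] [T2Space Y] : T2Space (UnifiedSpace f) := by
  have hXY : ∀ x y, ∃ u v : Set (UnifiedSpace f), IsOpen u ∧ IsOpen v ∧ inX x ∈ u ∧ inY y ∈ v ∧
      Disjoint u v := by
    intro x y
    obtain ⟨K, hK, hx⟩ := exists_compact_mem_nhds x
    exact ⟨inX '' interior K, (inX '' K)ᶜ, isOpen_image_inX f isOpen_interior,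
      isOpen_compl_image_inX f hK, ⟨x, mem_interior_iff_mem_nhds.2 hx, rfl⟩,
      inY_notMem_image_inX f y K, Set.disjoint_compl_right_iff_subset.2
        (Set.image_mono interior_subset)⟩
  refine ⟨?_⟩
  rintro (x | y) (x' | y') h
  · obtain ⟨u, v, hu, hv, hx, hx', huv⟩ := t2_separation fun e : x = x' => h (congrArg inX e)
    exact ⟨inX '' u, inX '' v, isOpen_image_inX f hu, isOpen_image_inX f hv, ⟨x, hx, rfl⟩,
      ⟨x', hx', rfl⟩, (Set.disjoint_image_iff (inX_injective f)).2 huv⟩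
  · exact hXY x y'
  · obtain ⟨u, v, hu, hv, hx, hy, huv⟩ := hXY x' y
    exact ⟨v, u, hv, hu, hy, hx, huv.symm⟩
  · obtain ⟨u, v, hu, hv, hx, hx', huv⟩ := t2_separation fun e : y = y' => h (congrArg inY e)
    exact ⟨proj f ⁻¹' u, proj f ⁻¹' v, hu.preimage (continuous_proj f),
      hv.preimage (continuous_proj f), hx, hx', huv.preimage _⟩

theorem isProperMap_proj [T2Space X] [T2Space Y] : IsProperMap (proj f) := by
  refine isProperMap_iff_ultrafilter.2 ⟨continuous_proj f, fun 𝒰 y h => ?_⟩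
  -- Either the ultrafilter lives on a compact subset of `X` and converges there, or it contains the
  -- complement of each such set and then every generating neighbourhood of `inY y`.
  by_cases hex : ∃ K : Set X, IsCompact K ∧ (inX : X → UnifiedSpace f) '' K ∈ 𝒰
  · obtain ⟨K, hK, hK𝒰⟩ := hex
    obtain ⟨z, -, hz⟩ := (hK.image (isOpenEmbedding_inX f).continuous).ultrafilter_le_nhds 𝒰
      (le_principal_iff.2 hK𝒰)
    exact ⟨z, tendsto_nhds_unique (((continuous_proj f).tendsto z).mono_left hz) h, hz⟩
  · push Not at hex
    refine ⟨inY y, rfl, ?_⟩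
    rw [TopologicalSpace.nhds_generateFrom]
    refine le_iInf₂ ?_
    rintro _ ⟨hy, ⟨U, -, rfl⟩ | ⟨V, K, hV, hK, rfl⟩⟩
    · exact (inY_notMem_image_inX f y U hy).elim
    · exact le_principal_iff.2 (inter_mem (h (hV.mem_nhds hy.1))
        (Ultrafilter.compl_mem_iff_notMem.2 (hex K hK)))

instance [LocallyCompactSpace X] [T2Space X] [LocallyCompactSpace Y] [T2Space Y] :
    LocallyCompactSpace (UnifiedSpace f) := by
  have : WeaklyLocallyCompactSpace (UnifiedSpace f) := by
    refine ⟨fun z => ?_⟩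
    obtain ⟨K, hK, hz⟩ := exists_compact_mem_nhds (proj f z)
    exact ⟨proj f ⁻¹' K, (isProperMap_proj f).isCompact_preimage hK,
      (continuous_proj f).continuousAt hz⟩
  infer_instance

/-! ### The canonical split extension -/

/-- Extension by zero of a function on `X` to the unified space. -/
noncomputable def extendZero (k : X → ℂ) : UnifiedSpace f → ℂ
  | inX x => k x
  | inY _ => 0

/-- Extension by zero creates no new superlevel sets. For `k` in `C₀(X)` their compactness gives
both continuity at the points of `Y` and vanishing at infinity. -/
theorem setOf_le_norm_extendZero (k : X → ℂ) {ε : ℝ} (hε : 0 < ε) :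
    {z | ε ≤ ‖extendZero f k z‖} = inX '' {x | ε ≤ ‖k x‖} := by
  ext (x | y)
  · exact ((inX_injective f).mem_set_image (s := {x | ε ≤ ‖k x‖})).symm
  · refine iff_of_false (fun h => ?_) (inY_notMem_image_inX f y _)
    change ε ≤ ‖(0 : ℂ)‖ at h
    rw [norm_zero] at h
    exact not_lt.2 h hε

theorem continuous_extendZero [T2Space X] (k : C₀(X, ℂ)) : Continuous (extendZero f k) := by
  refine continuous_iff_continuousAt.2 ?_
  rintro (x | y)
  · exact ((isOpenEmbedding_inX f).continuousAt_iff (g := extendZero f k)).1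
      (map_continuous k).continuousAt
  · refine Metric.tendsto_nhds.2 fun ε hε => ?_
    filter_upwards [compl_image_inX_mem_nhds f (k.isCompact_le_norm hε) y] with z hz
    rw [← setOf_le_norm_extendZero f k hε] at hz
    change dist _ (0 : ℂ) < ε
    rw [dist_zero_right]
    exact not_le.1 hz

/-- Extension by zero, as a `*`-homomorphism `C₀(X) → C₀(X ⊎_f Y)`. -/
noncomputable def extendZeroHom [T2Space X] : C₀(X, ℂ) →⋆ₙₐ[ℂ] C₀(UnifiedSpace f, ℂ) where
  toFun k := ⟨⟨extendZero f k, continuous_extendZero f k⟩,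
    tendsto_cocompact_zero_of_isCompact fun ε hε => by
      change IsCompact {z | ε ≤ ‖extendZero f k z‖}
      rw [setOf_le_norm_extendZero f k hε]
      exact (k.isCompact_le_norm hε).image (isOpenEmbedding_inX f).continuous⟩
  map_smul' r k := by
    ext (x | y)
    · rfl
    · exact (mul_zero r).symm
  map_zero' := by ext (x | y) <;> rfl
  map_add' k l := by
    ext (x | y)
    · rfl
    · exact (add_zero 0).symm
  map_mul' k l := by
    ext (x | y)
    · rfl
    · exact (mul_zero 0).symm
  map_star' k := by
    ext (x | y)
    · rfl
    · exact (star_zero ℂ).symm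

/-- Restriction to `Y`, as a `*`-homomorphism `C₀(X ⊎_f Y) → C₀(Y)`. -/
noncomputable def restrictHom : C₀(UnifiedSpace f, ℂ) →⋆ₙₐ[ℂ] C₀(Y, ℂ) :=
  ZeroAtInftyContinuousMap.compStarHom
    ⟨⟨inY, (isClosedEmbedding_inY f).continuous⟩, (isClosedEmbedding_inY f).tendsto_cocompact⟩

/-- A cutoff `h` equal to `1` on the `f`-image of the compact set where `‖k‖ ≥ ε / 2` moves `k` by
at most `ε / 2`, so single products are already dense. -/
theorem isMorphism_pullbackMultiplier [LocallyCompactSpace Y] [T2Space Y] :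
    IsMorphism (pullbackMultiplier f) := by
  refine Metric.dense_iff.2 fun k ε hε => ?_
  obtain ⟨h, h1, -, hn⟩ := exists_zeroAtInfty_eq_one_of_isCompact
    ((k.isCompact_le_norm (half_pos hε)).image f.continuous) isOpen_univ (Set.subset_univ _)
  refine ⟨(pullbackMultiplier f h).fst k, ?_, Submodule.subset_span ⟨h, k, rfl⟩⟩
  rw [mem_ball_iff_norm, norm_sub_rev]
  refine lt_of_le_of_lt (ZeroAtInftyContinuousMap.norm_le_of_forall _ (half_pos hε).le
    fun x => ?_) (half_lt_self hε)
  change ‖k x - h (f x) * k x‖ ≤ ε / 2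
  rw [← one_sub_mul, norm_mul]
  by_cases hx : ε / 2 ≤ ‖k x‖
  · rw [h1 _ ⟨x, hx, rfl⟩, sub_self, norm_zero, zero_mul]
    exact (half_pos hε).le
  · exact (mul_le_of_le_one_left (norm_nonneg _) (hn _)).trans (not_le.1 hx).le

variable [T2Space X]

theorem exact_extendZeroHom_restrictHom :
    Function.Exact (extendZeroHom f) (restrictHom f) := by
  intro a
  refine ⟨fun h => ?_, ?_⟩
  · have ha : ∀ y, a (inY y) = 0 := fun y => DFunLike.congr_fun h y
    refine ⟨⟨⟨fun x => a (inX x), (map_continuous a).comp (isOpenEmbedding_inX f).continuous⟩,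
      tendsto_cocompact_zero_of_isCompact fun ε hε => ?_⟩, ?_⟩
    -- Since `a` vanishes on `Y`, its superlevel set lies in the range of `inX`, so compactness
    -- passes to `X`.
    · refine ((isOpenEmbedding_inX f).isInducing.isCompact_preimage_iff ?_).2
        (a.isCompact_le_norm hε)
      rintro (x | y) hz
      · exact ⟨x, rfl⟩
      · change ε ≤ ‖a (inY y)‖ at hz
        rw [ha, norm_zero] at hz
        exact (not_lt.2 hz hε).elim
    · ext (x | y)
      · rfl
      · exact (ha y).symm
  · rintro ⟨k, rfl⟩
    rfl

variable [LocallyCompactSpace Y] [T2Space Y]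

/-- Composition with the canonical map, as a `*`-homomorphism `C₀(Y) → C₀(X ⊎_f Y)`. -/
noncomputable def pullbackHom : C₀(Y, ℂ) →⋆ₙₐ[ℂ] C₀(UnifiedSpace f, ℂ) :=
  ZeroAtInftyContinuousMap.compStarHom
    ⟨⟨proj f, continuous_proj f⟩, (isProperMap_iff_tendsto_cocompact.1 (isProperMap_proj f)).2⟩

/-- The canonical extension `0 → C₀(X) → C₀(X ⊎_f Y) → C₀(Y) → 0`. -/
noncomputable def extension : CStarExtension C₀(X, ℂ) C₀(UnifiedSpace f, ℂ) C₀(Y, ℂ) where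
  incl := extendZeroHom f
  quot := restrictHom f
  incl_injective _ _ h := ZeroAtInftyContinuousMap.ext fun x => DFunLike.congr_fun h (inX x)
  exact := exact_extendZeroHom_restrictHom f
  quot_surjective h := ⟨pullbackHom f h, rfl⟩

theorem isUnifiedExtension_extension : IsUnifiedExtension f (extension f) (pullbackHom f) where
  incl_inX _ _ := rfl
  incl_inY _ _ := rfl
  quot_apply _ _ := rfl
  section_apply _ _ := rfl

theorem isSplitting_pullbackHom : (extension f).IsSplitting (pullbackHom f) := fun _ => rfl

theorem toMultiplier_comp_pullbackHom :
    (extension f).toMultiplier.comp (pullbackHom f) = pullbackMultiplier f := by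
  refine NonUnitalStarAlgHom.ext fun h => ?_
  refine DoubleCentralizer.ext ℂ _ _ _ (Prod.ext ?_ ?_) <;>
    refine ContinuousLinearMap.ext fun k => ZeroAtInftyContinuousMap.ext fun x => ?_
  · exact DFunLike.congr_fun ((extension f).incl_mulLeft (pullbackHom f h) k) (inX x)
  · refine (DFunLike.congr_fun ((extension f).incl_mulRight (pullbackHom f h) k) (inX x)).trans ?_
    exact mul_comm (k x) (h (f x))

theorem coronaMk_comp_pullbackMultiplier :
    (coronaMk C₀(X, ℂ)).comp (pullbackMultiplier f) = (extension f).busby := by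
  refine NonUnitalStarAlgHom.ext fun h => ?_
  rw [← toMultiplier_comp_pullbackHom]
  exact ((extension f).busby_quot (pullbackHom f h)).symm

/-- Restriction to `X` and to `Y`, as a `*`-homomorphism from `C₀(X ⊎_f Y)` to the pullback. -/
noncomputable def toUnifiedAlgebra : C₀(UnifiedSpace f, ℂ) →⋆ₙₐ[ℂ] unifiedAlgebra f where
  toFun a := ⟨(a.toBCF.compContinuous ⟨inX, (isOpenEmbedding_inX f).continuous⟩,
    restrictHom f a), by
      obtain ⟨k, hk⟩ := (exact_extendZeroHom_restrictHom f (a - pullbackHom f (restrictHom f a))).1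
        (by rw [map_sub]; exact sub_self (restrictHom f a))
      exact ⟨k, BoundedContinuousFunction.ext fun x => DFunLike.congr_fun hk (inX x)⟩⟩
  map_smul' _ _ := rfl
  map_zero' := rfl
  map_add' _ _ := rfl
  map_mul' _ _ := rfl
  map_star' _ := rfl

theorem bijective_toUnifiedAlgebra : Function.Bijective (toUnifiedAlgebra f) := by
  constructor
  · intro a b hab
    have h := congrArg Subtype.val hab
    ext (x | y)
    · exact DFunLike.congr_fun (congrArg Prod.fst h) x
    · exact DFunLike.congr_fun (congrArg Prod.snd h) y
  · rintro ⟨⟨g, h⟩, k, hk⟩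
    refine ⟨extendZeroHom f k + pullbackHom f h, Subtype.ext (Prod.ext ?_ ?_)⟩
    · refine BoundedContinuousFunction.ext fun x => ?_
      have hx : k x = g x - h (f x) := DFunLike.congr_fun hk x
      change k x + h (f x) = g x
      rw [hx, sub_add_cancel]
    · exact ZeroAtInftyContinuousMap.ext fun y => zero_add (h y)

end UnifiedSpace

/-! ### Split extensions are determined by the lift of their Busby invariant -/

section SplitExtensions

variable {A B E E' : Type*} [NonUnitalCStarAlgebra A] [NonUnitalCStarAlgebra B]
  [NonUnitalCStarAlgebra E] [NonUnitalCStarAlgebra E']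

namespace CStarExtension

theorem IsSplitting.exists_eq_incl_add {ext : CStarExtension B E A} {s : A →⋆ₙₐ[ℂ] E}
    (hs : ext.IsSplitting s) (e : E) : ∃ b, e = ext.incl b + s (ext.quot e) := by
  obtain ⟨b, hb⟩ := (ext.exact (e - s (ext.quot e))).1 (by rw [map_sub, hs, sub_self])
  exact ⟨b, by rw [hb, sub_add_cancel]⟩

theorem IsSplitting.quot_incl_add {ext : CStarExtension B E A} {s : A →⋆ₙₐ[ℂ] E}
    (hs : ext.IsSplitting s) (b : B) (a : A) : ext.quot (ext.incl b + s a) = a := by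
  rw [map_add, ext.exact.apply_apply_eq_zero, hs, zero_add]

theorem IsSplitting.incl_add_injective {ext : CStarExtension B E A} {s : A →⋆ₙₐ[ℂ] E}
    (hs : ext.IsSplitting s) {b b' : B} {a a' : A}
    (h : ext.incl b + s a = ext.incl b' + s a') : b = b' ∧ a = a' := by
  have ha : a = a' := by rw [← hs.quot_incl_add b a, h, hs.quot_incl_add]
  subst ha
  exact ⟨ext.incl_injective (add_right_cancel h), rfl⟩

/-- Both cross terms lie in the ideal, so the multiplication of `E` depends on the extension only
through `α ∘ s`. -/
theorem incl_add_mul_incl_add (ext : CStarExtension B E A) (s : A →⋆ₙₐ[ℂ] E) (b b' : B)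
    (a a' : A) : (ext.incl b + s a) * (ext.incl b' + s a') =
      ext.incl (b * b' + (ext.toMultiplier (s a)).fst b' + (ext.toMultiplier (s a')).snd b) +
        s (a * a') := by
  change _ = ext.incl (b * b' + ext.mulLeft (s a) b' + ext.mulRight (s a') b) + _
  rw [map_add, map_add, incl_mulLeft, incl_mulRight, map_mul, map_mul, add_mul, mul_add, mul_add]
  abel

/-- Two split extensions of `A` by `B` for which the lifts of the Busby invariants agree are
isomorphic as split extensions. -/
theorem exists_equiv_of_toMultiplier_comp_eq (ext : CStarExtension B E A)
    (ext' : CStarExtension B E' A) {s : A →⋆ₙₐ[ℂ] E} {s' : A →⋆ₙₐ[ℂ] E'}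
    (hs : ext.IsSplitting s) (hs' : ext'.IsSplitting s')
    (h : ext.toMultiplier.comp s = ext'.toMultiplier.comp s') :
    ∃ Φ : E ≃⋆ₐ[ℂ] E', (∀ b, Φ (ext.incl b) = ext'.incl b) ∧
      (∀ e, ext'.quot (Φ e) = ext.quot e) ∧ ∀ a, Φ (s a) = s' a := by
  have hm : ∀ a, ext.toMultiplier (s a) = ext'.toMultiplier (s' a) := DFunLike.congr_fun h
  choose r hr using hs.exists_eq_incl_add
  let F : E → E' := fun e => ext'.incl (r e) + s' (ext.quot e)
  -- Uniqueness of the decomposition makes the chosen `r` harmless; all algebraic properties of `F`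
  -- are read off from this formula.
  have hF : ∀ b a, F (ext.incl b + s a) = ext'.incl b + s' a := by
    intro b a
    obtain ⟨h1, h2⟩ := hs.incl_add_injective (hr (ext.incl b + s a))
    change ext'.incl (r _) + s' (ext.quot _) = _
    rw [← h1, ← h2]
  let Φ : E →⋆ₙₐ[ℂ] E' :=
    { toFun := F
      map_smul' := fun c e => by
        rw [hr e, smul_add, ← map_smul, ← map_smul, hF, hF, map_smul, map_smul, smul_add]
        rfl
      map_zero' := by
        have := hF 0 0
        rwa [map_zero, map_zero, map_zero, map_zero, add_zero, add_zero] at this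
      map_add' := fun e e' => by
        rw [hr e, hr e', add_add_add_comm, ← map_add, ← map_add, hF, hF, hF, map_add, map_add,
          add_add_add_comm]
      map_mul' := fun e e' => by
        rw [hr e, hr e', incl_add_mul_incl_add, hF, hF, hF, incl_add_mul_incl_add, hm, hm]
      map_star' := fun e => by
        rw [hr e, star_add, ← map_star, ← map_star, hF, hF, map_star, map_star, star_add] }
  have hΦ : ∀ b a, Φ (ext.incl b + s a) = ext'.incl b + s' a := hF
  have hbij : Function.Bijective Φ := by
    constructor
    · intro e e' hee
      rw [hr e, hr e', hΦ, hΦ] at hee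
      obtain ⟨h1, h2⟩ := hs'.incl_add_injective hee
      rw [hr e, hr e', h1, h2]
    · intro e'
      obtain ⟨b, hb⟩ := hs'.exists_eq_incl_add e'
      exact ⟨ext.incl b + s (ext'.quot e'), by rw [hΦ, ← hb]⟩
  refine ⟨StarAlgEquiv.ofBijective Φ hbij, fun b => ?_, fun e => ?_, fun a => ?_⟩
  · have := hΦ b 0
    rwa [map_zero, map_zero, add_zero, add_zero] at this
  · exact hs'.quot_incl_add _ _
  · have := hΦ 0 a
    rwa [map_zero, map_zero, zero_add, zero_add] at this

end CStarExtension

end SplitExtensions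

/-! ### Morphisms from `C₀(Y)` to `C₀(X)` -/

section Morphisms

/-- By centrality the difference of the two sides is annihilated by every left factor; its own
adjoint and the C⋆-identity then force it to vanish. -/
theorem DoubleCentralizer.fst_mul_eq {B : Type*} [NonUnitalCStarAlgebra B] (m : 𝓜(ℂ, B))
    (b c : B) : m.fst (b * c) = m.fst b * c := by
  have key : ∀ z : B, z * (m.fst (b * c) - m.fst b * c) = 0 := by
    intro z
    rw [mul_sub, ← mul_assoc, ← m.central, ← m.central, mul_assoc, sub_self]
  have := key (star (m.fst (b * c) - m.fst b * c))
  rwa [CStarRing.star_mul_self_eq_zero_iff, sub_eq_zero] at this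

variable {X Y : Type*} [TopologicalSpace X] [TopologicalSpace Y]

/-- The ratio of `m.fst k x` to `k x` does not depend on `k`: it is the value at `x` of the function
that `m` represents. -/
theorem multiplier_fst_apply_mul (m : 𝓜(ℂ, C₀(X, ℂ))) (k l : C₀(X, ℂ)) (x : X) :
    m.fst k x * l x = m.fst l x * k x := by
  have h : m.fst k * l = m.fst l * k := by
    rw [← m.fst_mul_eq, ← m.fst_mul_eq, mul_comm]
  exact DFunLike.congr_fun h x

variable [LocallyCompactSpace X] [T2Space X]

theorem multiplier_snd_apply (m : 𝓜(ℂ, C₀(X, ℂ))) (k : C₀(X, ℂ)) (x : X) :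
    m.snd k x = m.fst k x := by
  obtain ⟨u, hu, -⟩ := exists_zeroAtInfty_apply_eq_one isOpen_univ (Set.mem_univ x)
  have h : m.snd k x * u x = k x * m.fst u x := DFunLike.congr_fun (m.central k u) x
  rw [mul_comm (k x), multiplier_fst_apply_mul m u k, hu, mul_one, mul_one] at h
  exact h

/-- The character of `ℳ(C₀(X))` given by a point `x`, computed with a function `u` that is equal
to `1` at `x`. -/
noncomputable def multiplierEval {u : C₀(X, ℂ)} {x : X} (hu : u x = 1) : 𝓜(ℂ, C₀(X, ℂ)) →⋆ₙₐ[ℂ] ℂ where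
  toFun m := m.fst u x
  map_smul' _ _ := rfl
  map_zero' := rfl
  map_add' _ _ := rfl
  map_mul' m n := by
    change m.fst (n.fst u) x = m.fst u x * n.fst u x
    rw [← mul_one (m.fst (n.fst u) x), ← hu, multiplier_fst_apply_mul]
  map_star' m := by
    change star (m.snd (star u) x) = star (m.fst u x)
    rw [multiplier_snd_apply, ← mul_one (m.fst (star u) x), ← hu, multiplier_fst_apply_mul]
    change star (m.fst u x * star (u x)) = _
    rw [hu, star_one, mul_one]

/-- Otherwise the whole span of products vanishes at `x` and stays at distance at least `1` from a
function with value `1` there. -/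
theorem IsMorphism.exists_fst_apply_ne_zero {φ : C₀(Y, ℂ) →⋆ₙₐ[ℂ] 𝓜(ℂ, C₀(X, ℂ))}
    (hφ : IsMorphism φ) (x : X) : ∃ h k, (φ h).fst k x ≠ 0 := by
  by_contra! hzero
  obtain ⟨u, hu, -⟩ := exists_zeroAtInfty_apply_eq_one isOpen_univ (Set.mem_univ x)
  obtain ⟨l, hl, hlu⟩ := Metric.dense_iff.1 hφ u 1 one_pos
  have hlx : l x = 0 := by
    refine Submodule.span_induction (p := fun l _ => l x = 0) ?_ rfl ?_ ?_ hlu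
    · rintro _ ⟨h, k, rfl⟩
      exact hzero h k
    · intro k k' _ _ hk hk'
      change k x + k' x = 0
      rw [hk, hk', add_zero]
    · intro c k _ hk
      change c * k x = 0
      rw [hk, mul_zero]
  have := (l - u).norm_apply_le_norm x
  rw [ZeroAtInftyContinuousMap.sub_apply, hlx, hu, zero_sub, norm_neg, norm_one] at this
  exact not_lt.2 this (mem_ball_iff_norm.1 hl)

variable [LocallyCompactSpace Y] [T2Space Y]

/-- Every morphism from `C₀(Y)` to `C₀(X)` is of the form `f*` for a continuous map `f`. -/
theorem IsMorphism.exists_eq_pullbackMultiplier {φ : C₀(Y, ℂ) →⋆ₙₐ[ℂ] 𝓜(ℂ, C₀(X, ℂ))}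
    (hφ : IsMorphism φ) : ∃ f : C(X, Y), φ = pullbackMultiplier f := by
  have hex : ∀ x, ∃ y, ∀ h k, (φ h).fst k x = h y * k x := by
    intro x
    obtain ⟨u, hu, -⟩ := exists_zeroAtInfty_apply_eq_one isOpen_univ (Set.mem_univ x)
    have hev : ∀ h k, (φ h).fst k x = (multiplierEval hu).comp φ h * k x := by
      intro h k
      change _ = (φ h).fst u x * k x
      rw [← multiplier_fst_apply_mul, hu, mul_one]
    obtain ⟨h, k, hne⟩ := hφ.exists_fst_apply_ne_zero x
    obtain ⟨y, hy⟩ := exists_eq_eval_of_ne_zero ((multiplierEval hu).comp φ)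
      ⟨h, fun h0 => hne (by rw [hev, h0, zero_mul])⟩
    exact ⟨y, fun h k => by rw [hev, hy]⟩
  choose f hf using hex
  -- With `h` a bump at `f x` vanishing off `U` and `k x = 1`, the function `(φ h).fst k`, equal to
  -- `(h ∘ f) k`, is continuous by construction. Near `x` it stays nonzero, which forces `f z ∈ U`.
  have hfc : Continuous f := by
    refine continuous_iff_continuousAt.2 fun x W hW => ?_
    obtain ⟨U, hUW, hU, hxU⟩ := mem_nhds_iff.1 hW
    obtain ⟨h, h1, h0⟩ := exists_zeroAtInfty_apply_eq_one hU hxU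
    obtain ⟨k, hk, -⟩ := exists_zeroAtInfty_apply_eq_one isOpen_univ (Set.mem_univ x)
    have hne : (φ h).fst k x ≠ 0 := by
      rw [hf, h1, hk, mul_one]
      exact one_ne_zero
    change ∀ᶠ z in 𝓝 x, f z ∈ W
    filter_upwards [(map_continuous ((φ h).fst k)).continuousAt.eventually_ne hne] with z hz
    refine hUW (by_contra fun hzU => hz ?_)
    rw [hf, h0 _ hzU, zero_mul]
  refine ⟨⟨f, hfc⟩, NonUnitalStarAlgHom.ext fun h => ?_⟩
  refine DoubleCentralizer.ext ℂ _ _ _ (Prod.ext ?_ ?_) <;>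
    refine ContinuousLinearMap.ext fun k => ZeroAtInftyContinuousMap.ext fun x => ?_
  · exact hf x h k
  · exact (multiplier_snd_apply (φ h) k x).trans (hf x h k)

end Morphisms

theorem mainTheorem3 {X : Type*} {Y : Type*} [TopologicalSpace X] [TopologicalSpace Y]
    [LocallyCompactSpace X] [T2Space X] [LocallyCompactSpace Y] [T2Space Y] :
    (∀ f : C(X, Y),
      -- the unified space is locally compact Hausdorff and its canonical map to `Y` is perfect
      (LocallyCompactSpace (UnifiedSpace f) ∧ T2Space (UnifiedSpace f) ∧
        IsProperMap (UnifiedSpace.proj f) ∧ Function.Surjective (UnifiedSpace.proj f)) ∧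
      -- the split extension, and `f*` as a morphism lifting its Busby invariant
      (∃ (ext : CStarExtension C₀(X, ℂ) C₀(UnifiedSpace f, ℂ) C₀(Y, ℂ))
          (s : C₀(Y, ℂ) →⋆ₙₐ[ℂ] C₀(UnifiedSpace f, ℂ)),
        IsUnifiedExtension f ext s ∧ ext.IsSplitting s ∧
        IsMorphism (pullbackMultiplier f) ∧
        ext.toMultiplier.comp s = pullbackMultiplier f ∧
        (coronaMk C₀(X, ℂ)).comp (pullbackMultiplier f) = ext.busby) ∧
      -- the pullback description
      (∃ Ψ : C₀(UnifiedSpace f, ℂ) ≃⋆ₐ[ℂ] unifiedAlgebra f,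
        ∀ a : C₀(UnifiedSpace f, ℂ),
          (∀ x : X, (Ψ a : (X →ᵇ ℂ) × C₀(Y, ℂ)).1 x = a (UnifiedSpace.inX x)) ∧
          (∀ y : Y, (Ψ a : (X →ᵇ ℂ) × C₀(Y, ℂ)).2 y = a (UnifiedSpace.inY y)))) ∧
    -- every split extension of `C₀(Y)` by `C₀(X)` comes from a continuous map
    (∀ {E : Type*} [NonUnitalCStarAlgebra E] (ext : CStarExtension C₀(X, ℂ) E C₀(Y, ℂ))
        (s : C₀(Y, ℂ) →⋆ₙₐ[ℂ] E),
      ext.IsSplitting s → IsMorphism (ext.toMultiplier.comp s) →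
      ∃ (f : C(X, Y)) (ext' : CStarExtension C₀(X, ℂ) C₀(UnifiedSpace f, ℂ) C₀(Y, ℂ))
          (s' : C₀(Y, ℂ) →⋆ₙₐ[ℂ] C₀(UnifiedSpace f, ℂ))
          (Φ : E ≃⋆ₐ[ℂ] C₀(UnifiedSpace f, ℂ)),
        IsUnifiedExtension f ext' s' ∧
        (∀ k, Φ (ext.incl k) = ext'.incl k) ∧
        (∀ e, ext'.quot (Φ e) = ext.quot e) ∧
        (∀ h, Φ (s h) = s' h)) := by
  refine ⟨fun f => ⟨⟨inferInstance, inferInstance, UnifiedSpace.isProperMap_proj f,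
    UnifiedSpace.surjective_proj f⟩, ?_, ?_⟩, ?_⟩
  · exact ⟨UnifiedSpace.extension f, UnifiedSpace.pullbackHom f,
      UnifiedSpace.isUnifiedExtension_extension f, UnifiedSpace.isSplitting_pullbackHom f,
      UnifiedSpace.isMorphism_pullbackMultiplier f, UnifiedSpace.toMultiplier_comp_pullbackHom f,
      UnifiedSpace.coronaMk_comp_pullbackMultiplier f⟩
  · exact ⟨StarAlgEquiv.ofBijective _ (UnifiedSpace.bijective_toUnifiedAlgebra f),
      fun a => ⟨fun x => rfl, fun y => rfl⟩⟩
  · intro E _ ext s hs hmor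
    obtain ⟨f, hf⟩ := hmor.exists_eq_pullbackMultiplier
    obtain ⟨Φ, h1, h2, h3⟩ := ext.exists_equiv_of_toMultiplier_comp_eq (UnifiedSpace.extension f)
      hs (UnifiedSpace.isSplitting_pullbackHom f)
      (hf.trans (UnifiedSpace.toMultiplier_comp_pullbackHom f).symm)
    exact ⟨f, UnifiedSpace.extension f, UnifiedSpace.pullbackHom f, Φ,
      UnifiedSpace.isUnifiedExtension_extension f, h1, h2, h3⟩
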